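/- Let $\mathbb K$ be $\mathbb R$ or $\mathbb C$. A \emph{rearrangement invariant (r.i.) space on $\mathbb N$} is a Banach space $X$ over $\mathbb K$ whose elements are scalar sequences $\mathbb N\to\mathbb K$ (with the pointwise linear operations), such that: (i) $X$ is solid: if $|f|\le|g|$ pointwise and $g\in X$, then $f\in X$ and $\|f\|\le\|g\|$; and $\mathbf 1_A\in X$ for every finite $A\subset\mathbb N$; (ii) for every bijection $\tau:\mathbb N\to\mathbb N$ and every $f\in\ell_1$, $f\in X$ if and only if $f\circ\tau^{-1}\in X$, and in this case $\|f\|=\|f\circ\tau^{-1}\|$; (iii) let $X'$ be the space of all sequences $g$ with $fg\in\ell_1$ for every $f\in X$, with the norm of the functional $f\mapsto\sum_n f(n)g(n)$ in $X^*$, and let $X''=(X')'$. Then $X'$ is norming, that is, $\|f\|_X=\sup\{|\sum_n f(n)g(n)| : g\in X',\ \|g\|_{X'}\le 1\}$ for every $f\in X$, so that $X\subset X''$ isometrically; and either $X=X''$, or $X$ is the closed linear span in $X''$ of the finitely supported sequences; (iv) $\ell_1\subset X\subset\ell_\infty$, with $\|f\|_X\le\|f\|_1$ for $f\in\ell_1$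 and $\|f\|_\infty\le\|f\|_X$ for $f\in X$. A Banach space $X$ has the \emph{alternative Daugavet property} if every operator $T:X\to X$ of the form $Tx=x^*(x)\,e$, with $x^*\in X^*$ and $e\in X$, satisfies $$\max_{|\theta|=1}\|\mathrm{Id}+\theta T\|=1+\|T\|,$$ where $\theta$ ranges over the scalars of modulus one. \textbf{Theorem.} Let $X$ be a non-separable r.i. space on $\mathbb N$. If $X$ has the alternative Daugavet property, then $X$ is $\ell_\infty$, that is, $X$ consists of all bounded scalar sequences and its norm is the supremum norm. -/

import Mathlib

open scoped ENNReal

namespace RISeq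

/-- The alternative Daugavet property of a normed space `X` over `𝕜`: for every rank-one operator
`T = f ⊗ e`, i.e. `T x = f x • e`, one has `max_{|θ| = 1} ‖Id + θ T‖ = 1 + ‖T‖`. -/
def HasADP (𝕜 X : Type*) [RCLike 𝕜] [NormedAddCommGroup X] [NormedSpace 𝕜 X] : Prop :=
  ∀ (f : StrongDual 𝕜 X) (e : X),
    IsGreatest
      {r : ℝ | ∃ θ : 𝕜, ‖θ‖ = 1 ∧ r = ‖ContinuousLinearMap.id 𝕜 X + θ • f.smulRight e‖}
      (1 + ‖f.smulRight e‖)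

section Dual

variable {𝕜 : Type*} [RCLike 𝕜]

/-- The Köthe dual of a set `S` of sequences: all `g` with `f g ∈ ℓ₁` for every `f ∈ S`. -/
def kotheDual (S : Set (ℕ → 𝕜)) : Set (ℕ → 𝕜) :=
  {g | ∀ f ∈ S, Summable fun n => ‖f n * g n‖}

/-- The norm of the functional `f ↦ ∑ f(n) g(n)`, where `B` is the unit ball of the space on which
this functional acts. -/
noncomputable def kotheDualNorm (B : Set (ℕ → 𝕜)) (g : ℕ → 𝕜) : ℝ≥0∞ :=
  ⨆ f ∈ B, ‖∑' n, f n * g n‖ₑ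

variable {X : Type*} [NormedAddCommGroup X] [NormedSpace 𝕜 X]

/-- `X'`, the integrals on a space `X` of sequences; `coord x` is the sequence that `x` is. -/
def integrals (coord : X →ₗ[𝕜] (ℕ → 𝕜)) : Set (ℕ → 𝕜) :=
  kotheDual (Set.range coord)

/-- The norm of `X'`, induced by that of `X*`. -/
noncomputable def integralNorm (coord : X →ₗ[𝕜] (ℕ → 𝕜)) : (ℕ → 𝕜) → ℝ≥0∞ :=
  kotheDualNorm (coord '' Metric.closedBall 0 1)

/-- The closed unit ball of `X'`. -/
def integralBall (coord : X →ₗ[𝕜] (ℕ → 𝕜)) : Set (ℕ → 𝕜) :=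
  {g | g ∈ integrals coord ∧ integralNorm coord g ≤ 1}

/-- `X'' = (X')'`. -/
def biIntegrals (coord : X →ₗ[𝕜] (ℕ → 𝕜)) : Set (ℕ → 𝕜) :=
  kotheDual (integrals coord)

/-- The norm of `X''`. -/
noncomputable def biIntegralNorm (coord : X →ₗ[𝕜] (ℕ → 𝕜)) : (ℕ → 𝕜) → ℝ≥0∞ :=
  kotheDualNorm (integralBall coord)

/-- The closed linear span in `X''` of the simple integrable functions on `ℕ`, which are the
finitely supported sequences (and already form a linear space). -/
def simpleClosure (coord : X →ₗ[𝕜] (ℕ → 𝕜)) : Set (ℕ → 𝕜) :=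
  {h | h ∈ biIntegrals coord ∧ ∀ ε : ℝ≥0∞, 0 < ε →
    ∃ s : ℕ → 𝕜, (Function.support s).Finite ∧ biIntegralNorm coord (h - s) ≤ ε}

/-- `X`, whose elements are sequences through the injective linear map `coord`, is a Köthe function
space on `ℕ` with the counting measure. (Completeness of `X` is a separate instance.) -/
structure IsKotheSequenceSpace (coord : X →ₗ[𝕜] (ℕ → 𝕜)) : Prop where
  injective : Function.Injective coord
  solid : ∀ (f : ℕ → 𝕜) (x : X), (∀ n, ‖f n‖ ≤ ‖coord x n‖) → ∃ y : X, coord y = f ∧ ‖y‖ ≤ ‖x‖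
  indicator_mem : ∀ A : Set ℕ, A.Finite → A.indicator (fun _ => (1 : 𝕜)) ∈ Set.range coord

/-- `X` is a rearrangement invariant space on `ℕ`. -/
structure IsRISequenceSpace (coord : X →ₗ[𝕜] (ℕ → 𝕜)) : Prop
    extends IsKotheSequenceSpace coord where
  /-- Invariance under the measure-preserving bijections of `ℕ`, asked for integrable sequences. -/
  rearrangement : ∀ (τ : Equiv.Perm ℕ) (f : ℕ → 𝕜), (Summable fun n => ‖f n‖) →
    (f ∈ Set.range coord ↔ f ∘ τ.symm ∈ Set.range coord) ∧
      ∀ x y : X, coord x = f → coord y = f ∘ τ.symm → ‖x‖ = ‖y‖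
  /-- `X'` is norming: the map `X → X''` is isometric. -/
  norming : ∀ x : X, biIntegralNorm coord (coord x) = ‖x‖ₑ
  /-- As a subspace of `X''`, `X` is `X''` or the closed linear span of the simple integrable
  functions. -/
  eq_bidual_or : Set.range coord = biIntegrals coord ∨ Set.range coord = simpleClosure coord
  /-- `ℓ₁ ⊂ X` with inclusion of norm one. -/
  l1_le : ∀ f : ℕ → 𝕜, (Summable fun n => ‖f n‖) → ∃ x : X, coord x = f ∧ ‖x‖ ≤ ∑' n, ‖f n‖
  /-- `X ⊂ ℓ_∞` with inclusion of norm one. -/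
  le_linfty : ∀ (x : X) (n : ℕ), ‖coord x n‖ ≤ ‖x‖

end Dual

end RISeq

namespace RISeq

/-! ### Slice form of the alternative Daugavet property -/

section ADP

variable {𝕜 X : Type*} [RCLike 𝕜] [NormedAddCommGroup X] [NormedSpace 𝕜 X]

/-! The property is used through slices: for `F` and `x` of norm one, the slice of the unit ball
given by `F` contains some `y` with `‖x + θ • y‖` almost `2`. Applied first to the `i`-th coordinate
functional, and then to a functional exposing the reflection in coordinate `i` of the point so
obtained, it yields an `x'` such that any `f` almost norming `x'` almost norms `x`, the point and,
up to a tail, its reflection. The parallelogram law then forces `‖f (e i)‖` to be almost `0` or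
almost `1` (`exists_dichotomy_step`).

Iterating over a finite support, the norm of a finitely supported `x` is the `ℓ₁`-norm of its
restriction to some `B` on which the norm of `X` dominates the `ℓ₁`-norm (`exists_dominatesSum`). By
rearrangement, whether `B` is such a set depends only on its size. If all sizes were allowed, `X`
would be `ℓ₁`, which is separable; so there is a largest size `N`, and the norm is the largest sum
of `N` moduli. For `N ≥ 2` this norm fails the property (`card_le_one_of_dominatesSum_iff`), so it
is the supremum norm. Then `X' ⊂ ℓ₁`, and `X = X''` contains every bounded sequence. -/

theorem exists_unit_mul_eq_norm (a : 𝕜) : ∃ c : 𝕜, ‖c‖ = 1 ∧ c * a = (‖a‖ : 𝕜) := by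
  rcases eq_or_ne a 0 with rfl | ha
  · exact ⟨1, by simp, by simp⟩
  · have h0 : (‖a‖ : 𝕜) ≠ 0 := by simpa using ha
    refine ⟨(‖a‖ : 𝕜) / a, ?_, div_mul_cancel₀ _ ha⟩
    rw [norm_div, RCLike.norm_ofReal, abs_norm, div_self (norm_ne_zero_iff.2 ha)]

/-- If `y + θ • F y • x` has norm almost `2`, then `F y` has modulus almost `1`. Rotating `y` makes
`F y` positive, and replacing it by `1` costs only `1 - ‖F y‖`. -/
theorem HasADP.exists_of_norm_eq_one (h : HasADP 𝕜 X) {F : StrongDual 𝕜 X} (hF : ‖F‖ = 1) {x : X}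
    (hx : ‖x‖ = 1) {ε : ℝ} (hε : 0 < ε) :
    ∃ (y : X) (θ : 𝕜), ‖y‖ ≤ 1 ∧ ‖θ‖ = 1 ∧ 1 - ε ≤ RCLike.re (F y) ∧ 2 - ε ≤ ‖x + θ • y‖ := by
  obtain ⟨⟨θ, hθ, hT⟩, -⟩ := h F x
  rw [ContinuousLinearMap.norm_smulRight_apply, hF, hx] at hT
  obtain ⟨y, hy, hy2⟩ : ∃ y : X, ‖y‖ < 1 ∧
      2 - ε / 2 < ‖(ContinuousLinearMap.id 𝕜 X + θ • F.smulRight x) y‖ := by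
    apply ContinuousLinearMap.exists_lt_apply_of_lt_opNorm
    rw [← hT]; linarith
  simp only [_root_.add_apply, ContinuousLinearMap.id_apply,
    _root_.smul_apply, ContinuousLinearMap.smulRight_apply] at hy2
  obtain ⟨c, hc, hcF⟩ := exists_unit_mul_eq_norm (F y)
  have hFy : ‖F y‖ ≤ 1 := (F.le_opNorm y).trans (by rw [hF]; linarith)
  have hlow : 1 - ε / 2 ≤ ‖F y‖ := by
    have := norm_add_le y (θ • F y • x)
    rw [norm_smul, norm_smul, hθ, hx] at this
    linarith
  have hθ0 : θ ≠ 0 := norm_ne_zero_iff.1 (by rw [hθ]; exact one_ne_zero)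
  refine ⟨c • y, θ⁻¹, ?_, by rw [norm_inv, hθ, inv_one], ?_, ?_⟩
  · rw [norm_smul, hc]; linarith
  · rw [map_smul, smul_eq_mul, hcF, RCLike.ofReal_re]; linarith
  · have h1 : ‖x + θ⁻¹ • c • y‖ = ‖c • y + θ • x‖ := by
      rw [show c • y + θ • x = θ • (x + θ⁻¹ • c • y) by
        rw [smul_add, smul_inv_smul₀ hθ0, add_comm], norm_smul, hθ, one_mul]
    have h2 : c • (y + θ • F y • x) = (c • y + θ • x) - (θ * ((1 - ‖F y‖ : ℝ) : 𝕜)) • x := by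
      have : c • θ • F y • x = (θ * (c * F y)) • x := by
        rw [smul_smul, smul_smul]; congr 1; ring
      rw [smul_add, this, hcF]
      push_cast
      module
    have h3 : ‖c • (y + θ • F y • x)‖ = ‖y + θ • F y • x‖ := by rw [norm_smul, hc, one_mul]
    have h4 := norm_sub_le (c • y + θ • x) ((θ * ((1 - ‖F y‖ : ℝ) : 𝕜)) • x)
    rw [← h2, h3, norm_smul, norm_mul, hθ, hx, RCLike.norm_ofReal,
      abs_of_nonneg (by linarith)] at h4
    rw [h1]; linarith

/-- Version without normalization, needed for exposing functionals and for averages whose norm is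
only almost one. -/
theorem HasADP.exists_slice (h : HasADP 𝕜 X) {F : StrongDual 𝕜 X} (hF : F ≠ 0) {x : X}
    (hx0 : x ≠ 0) (hx : ‖x‖ ≤ 1) {ε : ℝ} (hε : 0 < ε) :
    ∃ (y : X) (θ : 𝕜), ‖y‖ ≤ 1 ∧ ‖θ‖ = 1 ∧ ‖F‖ - ε ≤ RCLike.re (F y) ∧
      1 + ‖x‖ - ε ≤ ‖x + θ • y‖ := by
  have hF' : 0 < ‖F‖ := norm_pos_iff.2 hF
  have hx' : 0 < ‖x‖ := norm_pos_iff.2 hx0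
  have hδ : 0 < min ε (ε / ‖F‖) := by positivity
  obtain ⟨y, θ, hy, hθ, h1, h2⟩ := h.exists_of_norm_eq_one
    (F := ((‖F‖⁻¹ : ℝ) : 𝕜) • F) (x := ((‖x‖⁻¹ : ℝ) : 𝕜) • x)
    (by rw [norm_smul, RCLike.norm_ofReal, abs_of_pos (by positivity)]; field_simp)
    (by rw [norm_smul, RCLike.norm_ofReal, abs_of_pos (by positivity)]; field_simp) hδ
  refine ⟨y, θ, hy, hθ, ?_, ?_⟩
  · rw [_root_.smul_apply, smul_eq_mul, RCLike.re_ofReal_mul] at h1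
    have h3 : 1 - ε / ‖F‖ ≤ ‖F‖⁻¹ * RCLike.re (F y) := by linarith [min_le_right ε (ε / ‖F‖)]
    have h4 := mul_le_mul_of_nonneg_left h3 hF'.le
    rw [mul_inv_cancel_left₀ hF'.ne', mul_sub, mul_one, mul_div_cancel₀ _ hF'.ne'] at h4
    exact h4
  · have h3 : x + θ • y = (((‖x‖⁻¹ : ℝ) : 𝕜) • x + θ • y) - ((‖x‖⁻¹ - 1 : ℝ) : 𝕜) • x := by
      push_cast; module
    have h4 := norm_sub_norm_le (((‖x‖⁻¹ : ℝ) : 𝕜) • x + θ • y) (((‖x‖⁻¹ - 1 : ℝ) : 𝕜) • x)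
    rw [← h3, norm_smul, RCLike.norm_ofReal,
      abs_of_nonneg (by linarith [(one_le_inv₀ hx').2 hx]), sub_mul, inv_mul_cancel₀ hx'.ne'] at h4
    linarith [min_le_left ε (ε / ‖F‖)]

end ADP

/-! ### Coordinates, truncations and density -/

section Basic

variable {𝕜 : Type*} [RCLike 𝕜] {X : Type*} [NormedAddCommGroup X] [NormedSpace 𝕜 X]
  {coord : X →ₗ[𝕜] (ℕ → 𝕜)}

namespace IsRISequenceSpace

theorem norm_mono (hX : IsRISequenceSpace coord) {u v : X}
    (h : ∀ n, ‖coord u n‖ ≤ ‖coord v n‖) : ‖u‖ ≤ ‖v‖ := by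
  obtain ⟨y, hy, hyv⟩ := hX.solid (coord u) v h
  rwa [hX.injective hy] at hyv

theorem exists_coord_eq_single (hX : IsRISequenceSpace coord) (n : ℕ) :
    ∃ x : X, coord x = Pi.single n 1 := by
  obtain ⟨x, hx⟩ := hX.indicator_mem {n} (Set.finite_singleton n)
  refine ⟨x, hx.trans ?_⟩
  ext k
  by_cases hk : k = n
  · subst hk; simp
  · simp [hk]

/-- The unit vectors of a sequence space. -/
noncomputable def unitVec (hX : IsRISequenceSpace coord) (n : ℕ) : X :=
  (hX.exists_coord_eq_single n).choose

theorem coord_unitVec (hX : IsRISequenceSpace coord) (n : ℕ) :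
    coord (hX.unitVec n) = Pi.single n 1 :=
  (hX.exists_coord_eq_single n).choose_spec

/-- The coordinate functionals of a sequence space. -/
noncomputable def coordCLM (hX : IsRISequenceSpace coord) (n : ℕ) : StrongDual 𝕜 X :=
  LinearMap.mkContinuous ((LinearMap.proj n) ∘ₗ coord) 1
    fun x => by simpa using hX.le_linfty x n

@[simp] theorem coordCLM_apply (hX : IsRISequenceSpace coord) (n : ℕ) (x : X) :
    hX.coordCLM n x = coord x n := rfl

/-- The element with entries `a k` for `k ∈ A` and `0` elsewhere. -/
noncomputable def comb (hX : IsRISequenceSpace coord) (A : Finset ℕ) (a : ℕ → 𝕜) : X :=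
  ∑ k ∈ A, a k • hX.unitVec k

theorem coord_comb (hX : IsRISequenceSpace coord) (A : Finset ℕ) (a : ℕ → 𝕜) (n : ℕ) :
    coord (hX.comb A a) n = if n ∈ A then a n else 0 := by
  simp [comb, coord_unitVec, Pi.single_apply]

theorem coord_comb_mem (hX : IsRISequenceSpace coord) {A : Finset ℕ} (a : ℕ → 𝕜) {n : ℕ}
    (hn : n ∈ A) : coord (hX.comb A a) n = a n := by
  rw [hX.coord_comb, if_pos hn]

theorem norm_unitVec (hX : IsRISequenceSpace coord) (n : ℕ) : ‖hX.unitVec n‖ = 1 := by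
  apply le_antisymm
  · obtain ⟨x, hx, hx1⟩ := hX.l1_le (Pi.single n 1)
      (summable_of_ne_finset_zero (s := {n}) (by intro b hb; simp at hb; simp [hb]))
    rw [hX.injective (hx.trans (hX.coord_unitVec n).symm)] at hx1
    rw [tsum_eq_single n (by intro b hb; simp [hb])] at hx1
    simpa using hx1
  · simpa [coord_unitVec] using hX.le_linfty (hX.unitVec n) n

theorem norm_comb_le (hX : IsRISequenceSpace coord) (A : Finset ℕ) (a : ℕ → 𝕜) :
    ‖hX.comb A a‖ ≤ ∑ k ∈ A, ‖a k‖ :=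
  norm_sum_le_of_le _ fun k _ => by rw [norm_smul, norm_unitVec, mul_one]

theorem norm_comb_coord_le (hX : IsRISequenceSpace coord) (A : Finset ℕ) (x : X) :
    ‖hX.comb A (coord x)‖ ≤ ‖x‖ :=
  hX.norm_mono fun n => by
    rw [hX.coord_comb]; split_ifs <;> simp

theorem apply_comb (hX : IsRISequenceSpace coord) (f : StrongDual 𝕜 X) (A : Finset ℕ)
    (a : ℕ → 𝕜) : f (hX.comb A a) = ∑ k ∈ A, a k * f (hX.unitVec k) := by
  simp [comb]

theorem comb_eq_self (hX : IsRISequenceSpace coord) {A : Finset ℕ} {x : X}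
    (h : ∀ n, n ∉ A → coord x n = 0) : hX.comb A (coord x) = x := by
  apply hX.injective
  ext n
  rw [hX.coord_comb]
  split_ifs with hn
  · rfl
  · exact (h n hn).symm

/-- The finitely supported functional with coefficients `b k`, `k ∈ A`. -/
noncomputable def finFunctional (hX : IsRISequenceSpace coord) (A : Finset ℕ) (b : ℕ → 𝕜) :
    StrongDual 𝕜 X :=
  ∑ k ∈ A, b k • hX.coordCLM k

theorem finFunctional_apply (hX : IsRISequenceSpace coord) (A : Finset ℕ) (b : ℕ → 𝕜) (x : X) :
    hX.finFunctional A b x = ∑ k ∈ A, b k * coord x k := by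
  simp [finFunctional]

/-- The norm is the limit of the norms of the truncations, because `X'` is norming. -/
theorem exists_lt_norm_trunc (hX : IsRISequenceSpace coord) (x : X) {ε : ℝ} (hε : 0 < ε) :
    ∃ M, ∀ m, M ≤ m → ‖x‖ - ε < ‖hX.comb (Finset.range m) (coord x)‖ := by
  rcases le_or_gt (‖x‖) 0 with h0 | h0
  · exact ⟨0, fun m _ => by linarith [norm_nonneg (hX.comb (Finset.range m) (coord x))]⟩
  have hlt : ENNReal.ofReal (‖x‖ - ε) < biIntegralNorm coord (coord x) := by
    rw [hX.norming, ← ofReal_norm]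
    exact (ENNReal.ofReal_lt_ofReal_iff h0).2 (by linarith)
  rw [biIntegralNorm, kotheDualNorm] at hlt
  obtain ⟨g, hlt⟩ := lt_iSup_iff.1 hlt
  obtain ⟨hg, hlt⟩ := lt_iSup_iff.1 hlt
  have hsum : Summable fun n => g n * coord x n :=
    Summable.of_norm (by simpa [norm_mul, mul_comm] using hg.1 (coord x) ⟨x, rfl⟩)
  rw [← ofReal_norm] at hlt
  have hlt' : ‖x‖ - ε < ‖∑' n, g n * coord x n‖ := by
    by_contra! hc
    exact absurd (ENNReal.ofReal_le_ofReal hc) (not_le.2 hlt)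
  have htend := hsum.hasSum.tendsto_sum_nat.norm
  obtain ⟨M, hM⟩ := Filter.eventually_atTop.1 (htend.eventually_const_lt hlt')
  refine ⟨M, fun m hm => (hM m hm).trans_le ?_⟩
  -- A partial sum of the pairing of `g` with `x` is the full pairing of `g` with a truncation of
  -- `x`.
  have h1 : ‖∑' n, g n * coord (hX.comb (Finset.range m) (coord x)) n‖ₑ ≤
      ‖hX.comb (Finset.range m) (coord x)‖ₑ := by
    rw [← hX.norming, biIntegralNorm, kotheDualNorm]
    exact le_iSup₂ (f := fun (f : ℕ → 𝕜) (_ : f ∈ integralBall coord) =>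
      ‖∑' n, f n * coord (hX.comb (Finset.range m) (coord x)) n‖ₑ) g hg
  rw [tsum_eq_sum (s := Finset.range m)
    (by intro b hb; rw [hX.coord_comb, if_neg hb, mul_zero])] at h1
  rw [Finset.sum_congr rfl (fun k hk => by rw [hX.coord_comb_mem _ hk])] at h1
  rwa [← ofReal_norm, ← ofReal_norm,
    ENNReal.ofReal_le_ofReal_iff (norm_nonneg _)] at h1

theorem separableSpace_of_dense (hX : IsRISequenceSpace coord)
    (h : ∀ (x : X) (ε : ℝ), 0 < ε → ∃ (A : Finset ℕ) (a : ℕ → 𝕜), ‖x - hX.comb A a‖ < ε) :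
    TopologicalSpace.SeparableSpace X := by
  have h1 : TopologicalSpace.IsSeparable
      (Submodule.span 𝕜 (Set.range hX.unitVec) : Set X) :=
    (Set.countable_range hX.unitVec).isSeparable.span
  have h2 : Dense (Submodule.span 𝕜 (Set.range hX.unitVec) : Set X) := by
    intro x
    rw [Metric.mem_closure_iff]
    intro ε hε
    obtain ⟨A, a, hA⟩ := h x ε hε
    refine ⟨hX.comb A a, ?_, by rwa [dist_eq_norm]⟩
    exact Submodule.sum_mem _ fun k _ =>
      Submodule.smul_mem _ _ (Submodule.subset_span ⟨k, rfl⟩)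
  rw [← TopologicalSpace.isSeparable_univ_iff, ← h2.closure_eq]
  exact h1.closure

/-- In the other case the unit vectors span a dense subspace, and `X` is separable. -/
theorem range_eq_biIntegrals (hX : IsRISequenceSpace coord)
    (hsep : ¬ TopologicalSpace.SeparableSpace X) : Set.range coord = biIntegrals coord := by
  rcases hX.eq_bidual_or with h | h
  · exact h
  · refine absurd (hX.separableSpace_of_dense fun x ε hε => ?_) hsep
    have hx : coord x ∈ simpleClosure coord := h ▸ ⟨x, rfl⟩
    obtain ⟨s, hs, hle⟩ := hx.2 (ENNReal.ofReal (ε / 2)) (by simpa using hε)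
    refine ⟨hs.toFinset, s, ?_⟩
    have h1 : coord (hX.comb hs.toFinset s) = s := by
      ext n
      rw [hX.coord_comb]
      split_ifs with hn
      · rfl
      · simpa [eq_comm] using hn
    rw [← h1, ← map_sub, hX.norming, ← ofReal_norm,
      ENNReal.ofReal_le_ofReal_iff (by positivity)] at hle
    linarith

end IsRISequenceSpace

end Basic

end RISeq

namespace RISeq

/-! ### Exposed points of finite sections and reflections -/

section Exposed

variable {𝕜 : Type*} [RCLike 𝕜] {X : Type*} [NormedAddCommGroup X] [NormedSpace 𝕜 X]
  {coord : X →ₗ[𝕜] (ℕ → 𝕜)}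

/-- If `|A + B|` and `|A - B|` are almost `1` while `|A| + |B| ≤ 1`, then one of `A`, `B` is almost
`0`. -/
theorem norm_mul_norm_le_of_parallelogram {A B : 𝕜} {t : ℝ} (ht : t ≤ 1) (h1 : 1 - t ≤ ‖A + B‖)
    (h2 : 1 - t ≤ ‖A - B‖) (h3 : ‖A‖ + ‖B‖ ≤ 1) : ‖A‖ * ‖B‖ ≤ t := by
  have hp : ‖A + B‖ ^ 2 + ‖A - B‖ ^ 2 = 2 * (‖A‖ ^ 2 + ‖B‖ ^ 2) := by
    simp only [RCLike.norm_sq_eq_def, map_add, map_sub]; ring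
  have := norm_nonneg A
  have := norm_nonneg B
  have e1 : (1 - t) ^ 2 ≤ ‖A + B‖ ^ 2 := by gcongr
  have e2 : (1 - t) ^ 2 ≤ ‖A - B‖ ^ 2 := by gcongr
  have e3 : (‖A‖ + ‖B‖) ^ 2 ≤ 1 ^ 2 := by gcongr
  nlinarith

namespace IsRISequenceSpace

/-- In a finite section of the unit ball, every element is, as far as a given functional can see,
as good as a strongly exposed point. -/
theorem exists_exposed (hX : IsRISequenceSpace coord) (A : Finset ℕ) (c : ℕ → 𝕜) {y : X}
    (hy : ‖y‖ ≤ 1) {η : ℝ} (hη : 0 < η) :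
    ∃ (a b : ℕ → 𝕜) (κ : ℝ), 0 < κ ∧ ‖hX.comb A a‖ ≤ 1 ∧
      RCLike.re (∑ k ∈ A, c k * coord y k) - η ≤ RCLike.re (∑ k ∈ A, c k * a k) ∧
      ∀ v : X, ‖v‖ ≤ 1 → κ * ∑ k ∈ A, ‖coord v k - a k‖ ^ 2 ≤
        RCLike.re (∑ k ∈ A, b k * a k) - RCLike.re (∑ k ∈ A, b k * coord v k) := by
  -- Small enough for the quadratic term of `G` to stay below `η` on the unit ball, where all
  -- coordinates are at most `1` in modulus.
  set κ : ℝ := η / (A.card + 1) with hκ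
  have hκ0 : 0 < κ := by positivity
  have hκA : κ * A.card ≤ η := by
    rw [hκ, div_mul_eq_mul_div, div_le_iff₀ (by positivity)]
    nlinarith
  let G : (ℕ → 𝕜) → ℝ := fun a =>
    RCLike.re (∑ k ∈ A, c k * a k) + κ * ∑ k ∈ A, ‖a k‖ ^ 2
  let K : Set (ℕ → 𝕜) :=
    (Set.univ.pi fun _ => Metric.closedBall (0 : 𝕜) 1) ∩ {a | ‖hX.comb A a‖ ≤ 1}
  have hK : IsCompact K := by
    refine (isCompact_univ_pi fun _ => isCompact_closedBall 0 1).inter_right ?_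
    refine isClosed_le ?_ continuous_const
    unfold comb
    fun_prop
  have hball : ∀ v : X, ‖v‖ ≤ 1 → coord v ∈ K := fun v hv =>
    ⟨fun n _ => by simpa using (hX.le_linfty v n).trans hv, (hX.norm_comb_coord_le A v).trans hv⟩
  obtain ⟨a, ha, hmax⟩ := hK.exists_isMaxOn ⟨_, hball y hy⟩
    (f := G) (by fun_prop)
  have hG : ∀ v : X, ‖v‖ ≤ 1 → G (coord v) ≤ G a := fun v hv => hmax (hball v hv)
  -- The new coefficients are the gradient of `G` at its maximizer `a`. Expanding the squares, the
  -- required inequality is exactly `G (coord v) ≤ G a`.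
  refine ⟨a, fun k => c k + ((2 * κ : ℝ) : 𝕜) * (starRingEnd 𝕜) (a k), κ, hκ0, ha.2, ?_, ?_⟩
  · have h1 := hG y hy
    have h2 : ∑ k ∈ A, ‖a k‖ ^ 2 ≤ A.card := by
      have : ∀ k ∈ A, ‖a k‖ ^ 2 ≤ 1 := fun k _ =>
        pow_le_one₀ (norm_nonneg _) (by simpa using ha.1 k trivial)
      simpa using Finset.sum_le_sum this
    have h3 : 0 ≤ κ * ∑ k ∈ A, ‖coord y k‖ ^ 2 := by positivity
    have h4 := mul_le_mul_of_nonneg_left h2 hκ0.le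
    simp only [G] at h1
    linarith
  · intro v hv
    have h1 := hG v hv
    simp only [G, map_sum, Finset.mul_sum] at h1 ⊢
    rw [← Finset.sum_add_distrib, ← Finset.sum_add_distrib, ← sub_nonneg,
      ← Finset.sum_sub_distrib] at h1
    rw [← Finset.sum_sub_distrib, ← sub_nonneg, ← Finset.sum_sub_distrib]
    refine h1.trans_eq (Finset.sum_congr rfl fun k _ => ?_)
    simp only [RCLike.norm_sq_eq_def, map_sub, map_add, RCLike.mul_re, RCLike.mul_im,
      RCLike.conj_re, RCLike.conj_im, RCLike.ofReal_re, RCLike.ofReal_im]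
    ring

/-- For disjointly supported `u` and `t`, the functional `f` cannot exceed `‖u + t‖` on the two
parts together. -/
theorem norm_apply_add_norm_apply_le (hX : IsRISequenceSpace coord) {f : StrongDual 𝕜 X}
    (hf : ‖f‖ ≤ 1) {u t w : X} (h : ∀ n, ‖coord u n‖ + ‖coord t n‖ ≤ ‖coord w n‖) :
    ‖f u‖ + ‖f t‖ ≤ ‖w‖ := by
  obtain ⟨c, hc, hcu⟩ := exists_unit_mul_eq_norm (f u)
  obtain ⟨d, hd, hdt⟩ := exists_unit_mul_eq_norm (f t)
  have h1 : ‖c • u + d • t‖ ≤ ‖w‖ := hX.norm_mono fun n => by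
    refine le_trans ?_ (h n)
    rw [map_add, map_smul, map_smul]
    refine (norm_add_le _ _).trans ?_
    simp [hc, hd]
  have h2 : f (c • u + d • t) = ((‖f u‖ + ‖f t‖ : ℝ) : 𝕜) := by
    rw [map_add, map_smul, map_smul, smul_eq_mul, smul_eq_mul, hcu, hdt]; push_cast; rfl
  calc ‖f u‖ + ‖f t‖ = ‖f (c • u + d • t)‖ := by
        rw [h2, RCLike.norm_ofReal, abs_of_nonneg (by positivity)]
    _ ≤ ‖f‖ * ‖c • u + d • t‖ := f.le_opNorm _
    _ ≤ 1 * ‖w‖ := by gcongr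
    _ = ‖w‖ := one_mul _

theorem norm_apply_le {f : StrongDual 𝕜 X} (hf : ‖f‖ ≤ 1) (x : X) : ‖f x‖ ≤ ‖x‖ :=
  (f.le_opNorm x).trans (mul_le_of_le_one_left (norm_nonneg x) hf)

/-- If `f` is almost `1` in modulus on `p` and on an element that is, up to a tail, close to the
reflection of `p` in the `i`-th coordinate, then the `i`-th coordinate contributes to `f p` almost
nothing or almost everything. -/
theorem norm_apply_unitVec_dichotomy (hX : IsRISequenceSpace coord) {A : Finset ℕ} {i : ℕ}
    (hi : i ∈ A) {a : ℕ → 𝕜} (ha : ‖hX.comb A a‖ ≤ 1) {y : X} (hy : ‖y‖ ≤ 1) {η : ℝ}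
    (hη0 : 0 ≤ η) (hη : 20 * η ≤ 1)
    (hya : ∑ k ∈ A, ‖coord y k - (if k = i then -a k else a k)‖ ≤ η)
    {f : StrongDual 𝕜 X} (hf : ‖f‖ ≤ 1) (hfp : 1 - 12 * η ≤ ‖f (hX.comb A a)‖)
    (hfy : 1 - 6 * η ≤ ‖f y‖) :
    ‖a i * f (hX.unitVec i)‖ * (1 - 12 * η - ‖a i * f (hX.unitVec i)‖) ≤ 20 * η := by
  set p := hX.comb A a with hp
  set a' : ℕ → 𝕜 := fun k => if k = i then -a k else a k with ha'
  set q := hX.comb A a' with hq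
  set d := hX.comb A (fun k => coord y k - a' k) with hd
  set t := y - d - q with ht
  have hdη : ‖d‖ ≤ η := (hX.norm_comb_le A _).trans hya
  have hnorm : ∀ k, ‖a' k‖ = ‖a k‖ := fun k => by
    simp only [ha']; split_ifs <;> simp
  -- On `A`, `t` vanishes and `y - d` has the moduli of `p`; off `A`, `p` vanishes and `y - d`
  -- equals `t`. As `f` almost norms `p`, it almost vanishes on the tail `t`.
  have hpt : ‖f p‖ + ‖f t‖ ≤ ‖y - d‖ := by
    refine hX.norm_apply_add_norm_apply_le hf fun n => ?_
    simp only [ht, map_sub, Pi.sub_apply, hp, hd, hq, hX.coord_comb]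
    split_ifs with hn
    · simp [hnorm]
    · simp
  have hyd : ‖y - d‖ ≤ 1 + η := (norm_sub_le _ _).trans (by linarith)
  have hfq : 1 - 20 * η ≤ ‖f q‖ := by
    have h1 : f y = f q + f t + f d := by rw [ht]; simp
    have h2 : ‖f y‖ ≤ ‖f q‖ + ‖f t‖ + ‖f d‖ := h1 ▸ norm_add₃_le
    have h3 := norm_apply_le hf d
    linarith
  set α := a i * f (hX.unitVec i) with hα
  set β := f p - α with hβ
  have hq2 : f q = β - α := by
    have : f p - f q = 2 * α := by
      rw [hp, hq, apply_comb, apply_comb, ← Finset.sum_sub_distrib,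
        Finset.sum_eq_single_of_mem i hi (by intro k _ hk; simp [ha', hk])]
      simp only [ha', if_true, hα]; ring
    rw [hβ]; linear_combination -this
  have hαβ : ‖α‖ + ‖β‖ ≤ 1 := by
    have e1 : α = f (a i • hX.unitVec i) := by rw [map_smul, smul_eq_mul]
    have e2 : β = f (p - a i • hX.unitVec i) := by rw [map_sub, ← e1]
    rw [e1, e2]
    refine (hX.norm_apply_add_norm_apply_le hf (w := p) fun n => ?_).trans ha
    simp only [map_sub, map_smul, Pi.sub_apply, Pi.smul_apply, coord_unitVec, smul_eq_mul, hp,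
      hX.coord_comb]
    by_cases hn : n = i
    · subst hn; simp [hi]
    · simp [hn]
  have hlow : 1 - 12 * η ≤ ‖α‖ + ‖β‖ := by
    have : f p = α + β := by rw [hβ]; ring
    exact hfp.trans (this ▸ norm_add_le _ _)
  have hprod : ‖α‖ * ‖β‖ ≤ 20 * η := by
    refine norm_mul_norm_le_of_parallelogram hη ?_ ?_ hαβ
    · have : α + β = f p := by rw [hβ]; ring
      rw [this]; linarith
    · rw [norm_sub_rev, ← hq2]; exact hfq
  exact (mul_le_mul_of_nonneg_left (by linarith) (norm_nonneg α)).trans hprod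

end IsRISequenceSpace

end Exposed

end RISeq

namespace RISeq

/-! ### Almost norming functionals with coefficients near 0 or 1 -/

section Dichotomy

variable {𝕜 : Type*} [RCLike 𝕜] {X : Type*} [NormedAddCommGroup X] [NormedSpace 𝕜 X]
  {coord : X →ₗ[𝕜] (ℕ → 𝕜)}

namespace IsRISequenceSpace

theorem norm_coordCLM (hX : IsRISequenceSpace coord) (i : ℕ) : ‖hX.coordCLM i‖ = 1 := by
  apply le_antisymm
  · exact ContinuousLinearMap.opNorm_le_bound _ zero_le_one fun x => by
      rw [one_mul]; exact hX.le_linfty x i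
  · have := (hX.coordCLM i).le_opNorm (hX.unitVec i)
    rw [hX.norm_unitVec, mul_one] at this
    simpa [coord_unitVec] using this

/-- A strongly exposed point `p` of a finite section of the unit ball that is almost aligned with
`x` and with the `i`-th unit vector; `b` exposes it. -/
theorem exists_exposed_aligned (hX : IsRISequenceSpace coord) (h : HasADP 𝕜 X) {x : X}
    (hx : ‖x‖ = 1) (i : ℕ) {η : ℝ} (hη : 0 < η) :
    ∃ (A : Finset ℕ) (a b : ℕ → 𝕜) (κ : ℝ) (θ : 𝕜), i ∈ A ∧ 0 < κ ∧ ‖θ‖ = 1 ∧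
      ‖hX.comb A a‖ ≤ 1 ∧ 1 - 4 * η ≤ ‖a i‖ ∧ 2 - 6 * η ≤ ‖x + θ • hX.comb A a‖ ∧
      ∀ v : X, ‖v‖ ≤ 1 → κ * ∑ k ∈ A, ‖coord v k - a k‖ ^ 2 ≤
        RCLike.re (∑ k ∈ A, b k * a k) - RCLike.re (∑ k ∈ A, b k * coord v k) := by
  obtain ⟨y, θ, hy, hθ, hyi, hxy⟩ := h.exists_of_norm_eq_one (hX.norm_coordCLM i) hx hη
  obtain ⟨M, hM⟩ := hX.exists_lt_norm_trunc (x + θ • y) hη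
  set A := Finset.range (max M (i + 1)) with hA
  have hi : i ∈ A := Finset.mem_range.2 (by omega)
  have hu := hM _ (le_max_left M (i + 1))
  rw [← hA] at hu
  obtain ⟨g, hg, hgu⟩ := exists_dual_vector'' 𝕜 (hX.comb A (coord (x + θ • y)))
  have hcomb : hX.comb A (coord (x + θ • y)) =
      hX.comb A (coord x) + θ • hX.comb A (coord y) := by
    simp [comb, Finset.smul_sum, add_smul, Finset.sum_add_distrib, mul_smul]
  have hre : ∀ v : X, ‖v‖ ≤ 1 → RCLike.re (g v) ≤ 1 := fun v hv =>
    (RCLike.re_le_norm _).trans ((norm_apply_le hg v).trans hv)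
  have hgx := hre _ ((hX.norm_comb_coord_le A x).trans hx.le)
  have hgy := hre (θ • hX.comb A (coord y))
    (by rw [norm_smul, hθ, one_mul]; exact (hX.norm_comb_coord_le A y).trans hy)
  have hsum : RCLike.re (g (hX.comb A (coord x))) + RCLike.re (g (θ • hX.comb A (coord y))) =
      ‖hX.comb A (coord (x + θ • y))‖ := by
    rw [← map_add, ← map_add, ← hcomb, hgu, RCLike.ofReal_re]
  -- Both summands have real part at most `1` on the unit ball and almost `1` at `y`, so a point
  -- losing at most `η` in their sum is almost optimal for each.
  have hc : ∀ v : ℕ → 𝕜, ∑ k ∈ A, (θ * g (hX.unitVec k) + if k = i then 1 else 0) * v k =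
      g (θ • hX.comb A v) + v i := fun v => by
    simp only [add_mul, Finset.sum_add_distrib, ite_mul, one_mul, zero_mul,
      Finset.sum_ite_eq', if_pos hi, map_smul, apply_comb, Finset.mul_sum, smul_eq_mul]
    congr 1
    exact Finset.sum_congr rfl fun k _ => by ring
  obtain ⟨a, b, κ, hκ, ha, hac, hexp⟩ := hX.exists_exposed A
    (fun k => θ * g (hX.unitVec k) + if k = i then 1 else 0) hy hη
  rw [hc, hc, map_add, map_add] at hac
  have hga := hre (θ • hX.comb A a) (by rw [norm_smul, hθ, one_mul]; exact ha)
  have hai : ‖a i‖ ≤ 1 := by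
    rw [← hX.coord_comb_mem a hi]; exact (hX.le_linfty _ i).trans ha
  have hai' := RCLike.re_le_norm (a i)
  rw [coordCLM_apply] at hyi
  refine ⟨A, a, b, κ, θ, hi, hκ, hθ, ha, by linarith, ?_, hexp⟩
  have h1 : RCLike.re (g (hX.comb A (coord x) + θ • hX.comb A a)) ≤
      ‖hX.comb A (coord x) + θ • hX.comb A a‖ :=
    (RCLike.re_le_norm _).trans (norm_apply_le hg _)
  have h2 : ‖hX.comb A (coord x) + θ • hX.comb A a‖ ≤ ‖x + θ • hX.comb A a‖ :=
    hX.norm_mono fun n => by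
      simp only [map_add, map_smul, Pi.add_apply, Pi.smul_apply, coord_comb]
      split_ifs <;> simp
  rw [map_add, map_add] at h1
  linarith

/-- The alternative Daugavet property applied to the functional that exposes the reflection of an
exposed point in the `i`-th coordinate. -/
theorem exists_near_reflection (hX : IsRISequenceSpace coord) (h : HasADP 𝕜 X) {A : Finset ℕ}
    {i : ℕ} (hi : i ∈ A) {a b : ℕ → 𝕜} {κ : ℝ} (hκ : 0 < κ) (ha : ‖hX.comb A a‖ ≤ 1)
    (hai : 0 < ‖a i‖)
    (hexp : ∀ v : X, ‖v‖ ≤ 1 → κ * ∑ k ∈ A, ‖coord v k - a k‖ ^ 2 ≤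
      RCLike.re (∑ k ∈ A, b k * a k) - RCLike.re (∑ k ∈ A, b k * coord v k))
    {w : X} (hw0 : w ≠ 0) (hw : ‖w‖ ≤ 1) {η : ℝ} (hη : 0 < η) :
    ∃ (y : X) (θ : 𝕜), ‖y‖ ≤ 1 ∧ ‖θ‖ = 1 ∧ 1 + ‖w‖ - η ≤ ‖w + θ • y‖ ∧
      ∑ k ∈ A, ‖coord y k - (if k = i then -a k else a k)‖ ≤ η := by
  let refl : (ℕ → 𝕜) → ℕ → 𝕜 := fun v k => if k = i then -v k else v k
  have hrefl : ∀ v k, ‖refl v k‖ = ‖v k‖ := fun v k => by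
    simp only [refl]; split_ifs <;> simp
  have hmul : ∀ (v : ℕ → 𝕜) k, refl b k * refl v k = b k * v k := fun v k => by
    simp only [refl]; split_ifs <;> ring
  have hmul' : ∀ (v : ℕ → 𝕜) k, b k * refl v k = refl b k * v k := fun v k => by
    simp only [refl]; split_ifs <;> ring
  set F := hX.finFunctional A (refl b) with hF
  have hpos : 0 < RCLike.re (∑ k ∈ A, b k * a k) := by
    have h1 := hexp 0 (by simp)
    simp only [map_zero, Pi.zero_apply, zero_sub, norm_neg, mul_zero, Finset.sum_const_zero,
      sub_zero] at h1
    refine lt_of_lt_of_le (mul_pos hκ ?_) h1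
    refine Finset.sum_pos' (fun k _ => by positivity) ⟨i, hi, ?_⟩
    positivity
  have hFnorm : RCLike.re (∑ k ∈ A, b k * a k) ≤ ‖F‖ := by
    have h1 : F (hX.comb A (refl a)) = ∑ k ∈ A, b k * a k := by
      rw [hF, finFunctional_apply]
      exact Finset.sum_congr rfl fun k hk => by rw [hX.coord_comb_mem _ hk, hmul]
    have h2 : ‖hX.comb A (refl a)‖ ≤ 1 := by
      refine le_trans (hX.norm_mono fun n => ?_) ha
      rw [hX.coord_comb, hX.coord_comb]; split_ifs
      · rw [hrefl]
      · simp
    rw [← h1]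
    exact (RCLike.re_le_norm _).trans
      ((F.le_opNorm _).trans (mul_le_of_le_one_right (norm_nonneg _) h2))
  -- With this depth the exposing inequality bounds the sum of squares by `η ^ 2 / (A.card + 1)`,
  -- and Cauchy–Schwarz bounds the `ℓ₁`-distance by `η`.
  set δ : ℝ := min η (κ * η ^ 2 / (A.card + 1)) with hδdef
  have hδ : 0 < δ := by positivity
  obtain ⟨y, θ, hy, hθ, hFy, hwy⟩ := h.exists_slice (F := F) (x := w)
    (norm_pos_iff.1 (hpos.trans_le hFnorm)) hw0 hw hδ
  refine ⟨y, θ, hy, hθ, by linarith [min_le_left η (κ * η ^ 2 / (A.card + 1))], ?_⟩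
  -- `F y` pairs `b` with the reflection of `y`, so that reflection is what lies close to `a`.
  have h1 := hexp (hX.comb A (refl (coord y))) (by
    refine le_trans (hX.norm_mono fun n => ?_) hy
    rw [hX.coord_comb]; split_ifs
    · rw [hrefl]
    · simp)
  have h2 : ∑ k ∈ A, b k * coord (hX.comb A (refl (coord y))) k = F y := by
    rw [hF, finFunctional_apply]
    exact Finset.sum_congr rfl fun k hk => by rw [hX.coord_comb_mem _ hk, hmul']
  have h3 : ∑ k ∈ A, ‖coord (hX.comb A (refl (coord y))) k - a k‖ ^ 2 =
      ∑ k ∈ A, ‖coord y k - refl a k‖ ^ 2 :=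
    Finset.sum_congr rfl fun k hk => by
      rw [hX.coord_comb_mem _ hk]
      simp only [refl]
      split_ifs
      · rw [← norm_neg]; congr 2; ring
      · rfl
  rw [h2, h3] at h1
  have h4 : κ * ∑ k ∈ A, ‖coord y k - refl a k‖ ^ 2 ≤ κ * η ^ 2 / (A.card + 1) := by
    linarith [min_le_right η (κ * η ^ 2 / (A.card + 1))]
  rw [mul_div_assoc, mul_le_mul_iff_right₀ hκ, le_div_iff₀ (by positivity)] at h4
  have h5 := sq_sum_le_card_mul_sum_sq (s := A) (f := fun k => ‖coord y k - refl a k‖)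
  have h6 : 0 ≤ ∑ k ∈ A, ‖coord y k - refl a k‖ ^ 2 := by positivity
  exact (le_abs_self _).trans (abs_le_of_sq_le_sq (by linarith) hη.le)

/-- Passing from `x` to a suitable `x'`, every functional that almost norms `x'` almost norms `x`
and has its `i`-th coefficient almost equal to `0` or `1` in modulus. -/
theorem exists_dichotomy_step (hX : IsRISequenceSpace coord) (h : HasADP 𝕜 X) {x : X}
    (hx : ‖x‖ = 1) (i : ℕ) {ε : ℝ} (hε : 0 < ε) (hε1 : ε ≤ 1) :
    ∃ (x' : X) (δ : ℝ), ‖x'‖ = 1 ∧ 0 < δ ∧ ∀ f : StrongDual 𝕜 X, ‖f‖ ≤ 1 → 1 - δ ≤ ‖f x'‖ →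
      1 - ε ≤ ‖f x‖ ∧ (‖f (hX.unitVec i)‖ ≤ ε ∨ 1 - ε ≤ ‖f (hX.unitVec i)‖) := by
  -- The final contradiction needs `20 * η < (ε / 2) ^ 2`; the errors linear in `η` are then
  -- absorbed by `ε`.
  set η : ℝ := ε ^ 2 / 1000 with hηdef
  have hη : 0 < η := by positivity
  have hηε : 1000 * η ≤ ε := by rw [hηdef]; nlinarith
  obtain ⟨A, a, b, κ, θ, hi, hκ, hθ, ha, hai, hxp, hexp⟩ := hX.exists_exposed_aligned h hx i hη
  set p := hX.comb A a with hp
  have hai1 : ‖a i‖ ≤ 1 := by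
    rw [← hX.coord_comb_mem a hi]; exact (hX.le_linfty _ i).trans ha
  have hp1 : ‖θ • p‖ ≤ 1 := by rw [norm_smul, hθ, one_mul]; exact ha
  set w : X := (2⁻¹ : 𝕜) • (x + θ • p) with hw
  have hwn : ‖w‖ = ‖x + θ • p‖ / 2 := by
    rw [hw, norm_smul, norm_inv, RCLike.norm_ofNat]; ring
  have hxp2 : ‖x + θ • p‖ ≤ 2 := (norm_add_le _ _).trans (by linarith)
  obtain ⟨y, θ', hy, hθ', hwy, hya⟩ := hX.exists_near_reflection h hi hκ ha (by linarith) hexp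
    (w := w) (norm_pos_iff.1 (by rw [hwn]; linarith)) (by rw [hwn]; linarith) hη
  set z := w + θ' • y with hz
  have hzn : 2 - 4 * η ≤ ‖z‖ := by linarith
  have hz0 : 0 < ‖z‖ := by linarith
  refine ⟨((‖z‖⁻¹ : ℝ) : 𝕜) • z, η, ?_, hη, fun f hf hfz => ?_⟩
  · rw [norm_smul, RCLike.norm_ofReal, abs_of_pos (by positivity), inv_mul_cancel₀ hz0.ne']
  have hfz' : 2 - 6 * η ≤ ‖f z‖ := by
    rw [map_smul, norm_smul, RCLike.norm_ofReal, abs_of_pos (by positivity)] at hfz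
    have := mul_le_mul_of_nonneg_left hfz hz0.le
    rw [mul_inv_cancel_left₀ hz0.ne'] at this
    nlinarith
  -- The left side is almost `2` and each norm on the right is at most `1`, so `f` almost norms `x`,
  -- `p` and `y` at once.
  have hfsum : ‖f z‖ ≤ ‖f x‖ / 2 + ‖f p‖ / 2 + ‖f y‖ := by
    have h1 : f z = 2⁻¹ * f x + 2⁻¹ * (θ * f p) + θ' * f y := by
      simp only [hz, hw, map_add, map_smul, smul_eq_mul]; ring
    rw [h1]
    refine norm_add₃_le.trans (le_of_eq ?_)
    simp only [norm_mul, norm_inv, RCLike.norm_ofNat, hθ, hθ']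
    ring
  have hfx := (norm_apply_le hf x).trans hx.le
  have hfp := (norm_apply_le hf p).trans ha
  have hfy := (norm_apply_le hf y).trans hy
  refine ⟨by linarith, ?_⟩
  have hdich := hX.norm_apply_unitVec_dichotomy hi ha hy hη.le (by linarith) hya hf
    (by linarith) (by linarith)
  rw [norm_mul] at hdich
  set s := ‖f (hX.unitVec i)‖ with hs
  have hs0 : 0 ≤ s := norm_nonneg _
  have hs1 : ‖a i‖ * s ≤ s := mul_le_of_le_one_left hs0 hai1
  by_contra! hcon
  have hl : ε / 2 < ‖a i‖ * s := by nlinarith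
  have hr : ε / 2 ≤ 1 - 12 * η - ‖a i‖ * s := by linarith
  have : ε / 2 * (ε / 2) ≤ 20 * η := by
    refine le_trans ?_ hdich
    gcongr
  rw [hηdef] at this
  nlinarith

/-- Induction on `s`: with tolerance `min δ₁ ε`, a functional almost norming the new vector almost
norms the previous one, hence inherits all earlier alternatives. -/
theorem exists_dichotomy (hX : IsRISequenceSpace coord) (h : HasADP 𝕜 X) (s : Finset ℕ) {x : X}
    (hx : ‖x‖ = 1) {ε : ℝ} (hε : 0 < ε) (hε1 : ε ≤ 1) :
    ∃ (x' : X) (δ : ℝ), ‖x'‖ = 1 ∧ 0 < δ ∧ ∀ f : StrongDual 𝕜 X, ‖f‖ ≤ 1 → 1 - δ ≤ ‖f x'‖ →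
      1 - ε ≤ ‖f x‖ ∧ ∀ i ∈ s, ‖f (hX.unitVec i)‖ ≤ ε ∨ 1 - ε ≤ ‖f (hX.unitVec i)‖ := by
  induction s using Finset.induction_on with
  | empty => exact ⟨x, ε, hx, hε, fun f _ hf => ⟨hf, by simp⟩⟩
  | insert j s _ ih =>
    obtain ⟨x₁, δ₁, hx₁, hδ₁, H⟩ := ih
    obtain ⟨x₂, δ₂, hx₂, hδ₂, H₂⟩ := hX.exists_dichotomy_step h hx₁ j
      (lt_min hδ₁ hε) ((min_le_right _ _).trans hε1)
    refine ⟨x₂, δ₂, hx₂, hδ₂, fun f hf hfx => ?_⟩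
    obtain ⟨h1, h2⟩ := H₂ f hf hfx
    obtain ⟨h3, h4⟩ := H f hf (by linarith [min_le_left δ₁ ε])
    refine ⟨h3, fun k hk => ?_⟩
    rcases Finset.mem_insert.1 hk with rfl | hk
    · exact h2.imp (fun h => h.trans (min_le_right _ _))
        (fun h => by linarith [min_le_right δ₁ ε])
    · exact h4 k hk

/-- Every norm-one `x` is almost normed by a functional whose coefficients on `s` are almost `0` or
`1` in modulus. -/
theorem exists_functional_dichotomy (hX : IsRISequenceSpace coord) (h : HasADP 𝕜 X)
    (s : Finset ℕ) {x : X} (hx : ‖x‖ = 1) {ε : ℝ} (hε : 0 < ε) (hε1 : ε ≤ 1) :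
    ∃ f : StrongDual 𝕜 X, ‖f‖ ≤ 1 ∧ 1 - ε ≤ ‖f x‖ ∧
      ∀ i ∈ s, ‖f (hX.unitVec i)‖ ≤ ε ∨ 1 - ε ≤ ‖f (hX.unitVec i)‖ := by
  obtain ⟨x', δ, hx', hδ, H⟩ := hX.exists_dichotomy h s hx hε hε1
  obtain ⟨f, hf, hfx⟩ := exists_dual_vector'' 𝕜 x'
  exact ⟨f, hf, H f hf (by rw [hfx, hx']; simp [hδ.le])⟩

end IsRISequenceSpace

end Dichotomy

end RISeq

namespace RISeq

/-! ### The norm as a largest sum of moduli -/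

section Sums

variable {𝕜 : Type*} [RCLike 𝕜] {X : Type*} [NormedAddCommGroup X] [NormedSpace 𝕜 X]
  {coord : X →ₗ[𝕜] (ℕ → 𝕜)}

theorem le_of_forall_le_add_mul {a b c : ℝ}
    (h : ∀ ε : ℝ, 0 < ε → ε ≤ 1 → a ≤ b + ε * c) : a ≤ b := by
  refine le_of_forall_pos_le_add fun t ht => ?_
  have hc : 0 < |c| + 1 := by positivity
  have h1 := h (min 1 (t / (|c| + 1))) (by positivity) (min_le_left _ _)
  have h2 : min 1 (t / (|c| + 1)) * c ≤ t / (|c| + 1) * (|c| + 1) :=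
    mul_le_mul_of_nonneg (min_le_right _ _) (by linarith [le_abs_self c]) (by positivity) hc.le
  rw [div_mul_cancel₀ _ hc.ne'] at h2
  linarith

/-- The norm dominates the `ℓ₁`-norm on `A`. -/
def DominatesSum (coord : X →ₗ[𝕜] (ℕ → 𝕜)) (A : Finset ℕ) : Prop :=
  ∀ v : X, ∑ i ∈ A, ‖coord v i‖ ≤ ‖v‖

theorem DominatesSum.mono {A B : Finset ℕ} (hA : DominatesSum coord A) (hBA : B ⊆ A) :
    DominatesSum coord B := fun v =>
  (Finset.sum_le_sum_of_subset_of_nonneg hBA fun _ _ _ => norm_nonneg _).trans (hA v)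

namespace IsRISequenceSpace

theorem sum_norm_mul_norm_le (hX : IsRISequenceSpace coord) {f : StrongDual 𝕜 X} (hf : ‖f‖ ≤ 1)
    (A : Finset ℕ) (v : X) : ∑ i ∈ A, ‖coord v i‖ * ‖f (hX.unitVec i)‖ ≤ ‖v‖ := by
  choose c hc hcv using fun i => exists_unit_mul_eq_norm (coord v i * f (hX.unitVec i))
  have h1 : f (hX.comb A fun i => c i * coord v i) =
      ((∑ i ∈ A, ‖coord v i‖ * ‖f (hX.unitVec i)‖ : ℝ) : 𝕜) := by
    rw [apply_comb]
    push_cast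
    refine Finset.sum_congr rfl fun i _ => ?_
    rw [mul_assoc, hcv, norm_mul]; push_cast; rfl
  have h2 : ‖hX.comb A fun i => c i * coord v i‖ ≤ ‖v‖ := hX.norm_mono fun n => by
    rw [hX.coord_comb]; split_ifs <;> simp [hc]
  have h3 := norm_apply_le hf (hX.comb A fun i => c i * coord v i)
  rw [h1, RCLike.norm_ofReal] at h3
  exact (le_abs_self _).trans (h3.trans h2)

/-- `B` collects the indices where the coefficient of `f` is almost `1`; every other index of `s`
contributes at most `ε * ‖x‖` to `f x`. -/
theorem exists_almost_dominatesSum (hX : IsRISequenceSpace coord) (h : HasADP 𝕜 X)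
    {s : Finset ℕ} {x : X} (hx0 : x ≠ 0) (hx : ∀ n, n ∉ s → coord x n = 0) {ε : ℝ} (hε : 0 < ε)
    (hε1 : ε ≤ 1) :
    ∃ B ⊆ s, (∀ v : X, ∑ i ∈ B, ‖coord v i‖ ≤ ‖v‖ + ε * ∑ i ∈ B, ‖coord v i‖) ∧
      ‖x‖ ≤ ∑ i ∈ B, ‖coord x i‖ + ε * (‖x‖ + s.card * ‖x‖) := by
  classical
  have hx' : 0 < ‖x‖ := norm_pos_iff.2 hx0
  obtain ⟨f, hf, hfx, hfs⟩ := hX.exists_functional_dichotomy h s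
    (x := ((‖x‖⁻¹ : ℝ) : 𝕜) • x)
    (by rw [norm_smul, RCLike.norm_ofReal, abs_of_pos (by positivity)]; field_simp) hε hε1
  have hfx' : (1 - ε) * ‖x‖ ≤ ‖f x‖ := by
    rw [map_smul, norm_smul, RCLike.norm_ofReal, abs_of_pos (by positivity)] at hfx
    have := mul_le_mul_of_nonneg_left hfx hx'.le
    rw [mul_inv_cancel_left₀ hx'.ne'] at this
    linarith
  set B := s.filter fun i => 1 - ε ≤ ‖f (hX.unitVec i)‖ with hB
  refine ⟨B, Finset.filter_subset _ _, fun v => ?_, ?_⟩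
  · have h1 : ∑ i ∈ B, (1 - ε) * ‖coord v i‖ ≤ ∑ i ∈ B, ‖coord v i‖ * ‖f (hX.unitVec i)‖ :=
      Finset.sum_le_sum fun i hi => by
        rw [mul_comm]
        exact mul_le_mul_of_nonneg_left (Finset.mem_filter.1 hi).2 (norm_nonneg _)
    rw [← Finset.mul_sum] at h1
    linarith [hX.sum_norm_mul_norm_le hf B v]
  · have h1 : ‖f x‖ ≤ ∑ i ∈ s, ‖coord x i‖ * ‖f (hX.unitVec i)‖ := by
      rw [← hX.comb_eq_self hx, apply_comb]
      refine (norm_sum_le _ _).trans (Finset.sum_le_sum fun i _ => ?_)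
      rw [norm_mul, hX.comb_eq_self hx]
    have h2 : ∑ i ∈ s, ‖coord x i‖ * ‖f (hX.unitVec i)‖ ≤
        ∑ i ∈ s, ((if 1 - ε ≤ ‖f (hX.unitVec i)‖ then ‖coord x i‖ else 0) + ε * ‖x‖) := by
      refine Finset.sum_le_sum fun i hi => ?_
      have h3 := hX.le_linfty x i
      have h4 := norm_nonneg (coord x i)
      split_ifs with hc
      · have h5 := norm_apply_le hf (hX.unitVec i)
        rw [hX.norm_unitVec] at h5
        have := mul_le_mul_of_nonneg_left h5 h4
        have : 0 ≤ ε * ‖x‖ := by positivity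
        linarith
      · have h5 := (hfs i hi).resolve_right hc
        rw [zero_add, mul_comm]
        gcongr
    rw [Finset.sum_add_distrib, ← Finset.sum_filter, Finset.sum_const, nsmul_eq_mul] at h2
    linarith

/-- Under the alternative Daugavet property, the norm of a finitely supported `x` is an
`ℓ₁`-norm of a restriction of `x`. -/
theorem exists_dominatesSum (hX : IsRISequenceSpace coord) (h : HasADP 𝕜 X)
    {s : Finset ℕ} {x : X} (hx : ∀ n, n ∉ s → coord x n = 0) :
    ∃ B : Finset ℕ, DominatesSum coord B ∧ ‖x‖ ≤ ∑ i ∈ B, ‖coord x i‖ := by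
  rcases eq_or_ne x 0 with rfl | hx0
  · exact ⟨∅, fun v => by simp, by simp⟩
  let P : ℝ → Finset ℕ → Prop := fun ε B =>
    (∀ v : X, ∑ i ∈ B, ‖coord v i‖ ≤ ‖v‖ + ε * ∑ i ∈ B, ‖coord v i‖) ∧
      ‖x‖ ≤ ∑ i ∈ B, ‖coord x i‖ + ε * (‖x‖ + s.card * ‖x‖)
  have hP : ∀ ε ε' B, ε ≤ ε' → P ε B → P ε' B := fun ε ε' B hle hPB => by
    refine ⟨fun v => (hPB.1 v).trans ?_, hPB.2.trans ?_⟩ <;> gcongr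
  -- One `B` serves all `ε` because `s` has finitely many subsets. If each failed at its own `ε`,
  -- the set found for the smallest of these would, by `hP`, also succeed at its own.
  obtain ⟨B, hB⟩ : ∃ B, ∀ ε, 0 < ε → ε ≤ 1 → P ε B := by
    by_contra! hcon
    choose ε hε hε1 hεP using hcon
    obtain ⟨B₀, -, hmin⟩ := s.powerset.exists_min_image ε ⟨∅, by simp⟩
    obtain ⟨B, hBs, hB⟩ := hX.exists_almost_dominatesSum h hx0 hx (hε B₀) (hε1 B₀)
    exact hεP B (hP _ _ _ (hmin B (Finset.mem_powerset.2 hBs)) hB)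
  exact ⟨B, fun v => le_of_forall_le_add_mul fun ε h0 h1 => (hB ε h0 h1).1 v,
    le_of_forall_le_add_mul fun ε h0 h1 => (hB ε h0 h1).2⟩

/-- Complements of finite sets are countably infinite, so some permutation of `ℕ` carries `B` onto
`A`. It is applied to the truncation of `v` to `B`, since invariance is assumed for summable
sequences only. -/
theorem dominatesSum_of_card_eq (hX : IsRISequenceSpace coord) {A B : Finset ℕ}
    (hA : DominatesSum coord A) (hAB : B.card = A.card) : DominatesSum coord B := by
  intro v
  have hfin : ∀ C : Finset ℕ, Infinite {n // ¬ n ∈ C} := fun C =>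
    (Finset.finite_toSet C).infinite_compl.to_subtype
  have := hfin A
  have := hfin B
  obtain ⟨f⟩ := nonempty_equiv_of_countable (α := {n // ¬ n ∈ B}) (β := {n // ¬ n ∈ A})
  let e : {n // n ∈ B} ≃ {n // n ∈ A} := Finset.equivOfCardEq hAB
  let τ : Equiv.Perm ℕ := Equiv.subtypeCongr e f
  have hτ : ∀ i, i ∈ B ↔ τ i ∈ A := fun i => by
    by_cases hi : i ∈ B
    · simp only [hi, τ, Equiv.subtypeCongr, Equiv.trans_apply,
        Equiv.sumCompl_symm_apply_of_pos hi, true_iff]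
      exact (e ⟨i, hi⟩).2
    · simp only [hi, τ, Equiv.subtypeCongr, Equiv.trans_apply,
        Equiv.sumCompl_symm_apply_of_neg hi, false_iff]
      exact (f ⟨i, hi⟩).2
  set u := hX.comb B (coord v) with hu
  have hsum : Summable fun n => ‖coord u n‖ :=
    summable_of_ne_finset_zero (s := B) (by intro b hb; rw [hu, hX.coord_comb, if_neg hb, norm_zero])
  obtain ⟨h1, h2⟩ := hX.rearrangement τ (coord u) hsum
  obtain ⟨y, hy⟩ := h1.1 ⟨u, rfl⟩
  have h3 := h2 u y rfl hy
  have h4 : ∑ i ∈ B, ‖coord v i‖ = ∑ i ∈ A, ‖coord y i‖ := by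
    refine Finset.sum_equiv τ hτ fun i hi => ?_
    rw [hy, Function.comp_apply, Equiv.symm_apply_apply, hu, hX.coord_comb_mem _ hi]
  rw [h4]
  exact (hA y).trans (h3 ▸ hX.norm_comb_coord_le B v)

theorem norm_le_of_forall_trunc (hX : IsRISequenceSpace coord) {x : X} {C : ℝ}
    (h : ∀ m, ‖hX.comb (Finset.range m) (coord x)‖ ≤ C) : ‖x‖ ≤ C := by
  refine le_of_forall_pos_le_add fun ε hε => ?_
  obtain ⟨M, hM⟩ := hX.exists_lt_norm_trunc x hε
  linarith [hM M le_rfl, h M]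

/-- Every element is then summable, and the norm of a tail is at most its `ℓ₁`-norm, so truncations
are dense. -/
theorem separableSpace_of_dominatesSum (hX : IsRISequenceSpace coord)
    (h : ∀ n, DominatesSum coord (Finset.range n)) : TopologicalSpace.SeparableSpace X := by
  classical
  refine hX.separableSpace_of_dense fun x ε hε => ?_
  have hs : Summable fun n => ‖coord x n‖ :=
    summable_of_sum_range_le (fun _ => norm_nonneg _) fun n => h n x
  obtain ⟨s, hs⟩ := summable_iff_vanishing_norm.1 hs (ε / 2) (by positivity)
  refine ⟨s, coord x, lt_of_le_of_lt (hX.norm_le_of_forall_trunc fun m => ?_) (half_lt_self hε)⟩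
  refine (hX.norm_comb_le _ _).trans ?_
  have h1 := hs (Finset.range m \ s) Finset.sdiff_disjoint
  refine le_trans (le_of_eq ?_) ((le_abs_self _).trans h1.le)
  rw [Finset.sdiff_eq_filter, Finset.sum_filter]
  refine Finset.sum_congr rfl fun k _ => ?_
  rw [map_sub, Pi.sub_apply, hX.coord_comb]
  split_ifs <;> simp_all

theorem norm_le_of_sum_le (hX : IsRISequenceSpace coord) (h : HasADP 𝕜 X) {N : ℕ}
    (hN : ∀ A, DominatesSum coord A → A.card ≤ N) {x : X} {c : ℝ}
    (hc : ∀ A : Finset ℕ, A.card ≤ N → ∑ i ∈ A, ‖coord x i‖ ≤ c) : ‖x‖ ≤ c := by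
  refine hX.norm_le_of_forall_trunc fun m => ?_
  obtain ⟨B, hB, hle⟩ := hX.exists_dominatesSum h (s := Finset.range m)
    (x := hX.comb (Finset.range m) (coord x)) (fun n hn => by rw [hX.coord_comb, if_neg hn])
  refine hle.trans (le_trans (Finset.sum_le_sum fun i _ => ?_) (hc B (hN B hB)))
  rw [hX.coord_comb]; split_ifs <;> simp

end IsRISequenceSpace

end Sums

end RISeq

namespace RISeq

/-! ### Excluding sums of several terms; identification with bounded sequences -/

section LInfty

variable {𝕜 : Type*} [RCLike 𝕜] {X : Type*} [NormedAddCommGroup X] [NormedSpace 𝕜 X]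
  {coord : X →ₗ[𝕜] (ℕ → 𝕜)}

/-- By the parallelogram law the sum is at most `2√2`. -/
theorem norm_sub_one_add_norm_add_one_le {θ : 𝕜} (hθ : ‖θ‖ = 1) :
    ‖1 - θ‖ + ‖1 + θ‖ ≤ 2.9 := by
  have h : ‖1 - θ‖ ^ 2 + ‖1 + θ‖ ^ 2 = 2 * (1 + ‖θ‖ ^ 2) := by
    simp only [RCLike.norm_sq_eq_def, map_add, map_sub, RCLike.one_re, RCLike.one_im]; ring
  rw [hθ] at h
  nlinarith [sq_nonneg (‖1 - θ‖ - ‖1 + θ‖), norm_nonneg (1 - θ), norm_nonneg (1 + θ)]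

theorem norm_sub_ofReal_le {b : 𝕜} {r δ : ℝ} (hr : 0 < r) (hr1 : r ≤ 1) (hδ : 1000 * δ ≤ r ^ 2)
    (h1 : r - δ ≤ RCLike.re b) (h2 : ‖b‖ ≤ 1.001 * r) : ‖b - (r : 𝕜)‖ ≤ r / 10 := by
  have h3 : ‖b - (r : 𝕜)‖ ^ 2 = ‖b‖ ^ 2 - 2 * r * RCLike.re b + r ^ 2 := by
    simp only [RCLike.norm_sq_eq_def, map_sub, RCLike.ofReal_re, RCLike.ofReal_im]; ring
  have h4 : ‖b‖ ^ 2 ≤ (1.001 * r) ^ 2 := by gcongr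
  have h5 := mul_le_mul_of_nonneg_left h1 hr.le
  have h6 : r * (1000 * δ) ≤ r ^ 2 := (mul_le_mul_of_nonneg_left hδ hr.le).trans (by nlinarith)
  refine (le_abs_self _).trans (abs_le_of_sq_le_sq ?_ (by positivity))
  nlinarith

/-- As `y₀` is near `-r` and `y₁` near `r`, no single rotation aligns both with `r`. -/
theorem norm_add_norm_le_of_opposite {r δ : ℝ} (hr : 0 < r) {y₀ y₁ θ : 𝕜} (hθ : ‖θ‖ = 1)
    (h₀ : ‖-y₀ - (r : 𝕜)‖ ≤ r / 10) (h₁ : ‖y₁ - (r : 𝕜)‖ ≤ r / 10) (hδ : 1000 * δ ≤ r)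
    (hy₀ : r - δ ≤ ‖y₀‖) (hy₁ : r - δ ≤ ‖y₁‖) :
    ‖(r : 𝕜) + θ * y₀‖ + ‖(r : 𝕜) + θ * y₁‖ ≤ 2 * r + ‖y₀‖ + ‖y₁‖ - r / 2 := by
  have e₀ : (r : 𝕜) + θ * y₀ = r * (1 - θ) - θ * (-y₀ - r) := by ring
  have e₁ : (r : 𝕜) + θ * y₁ = r * (1 + θ) + θ * (y₁ - r) := by ring
  have n₀ : ‖(r : 𝕜) + θ * y₀‖ ≤ r * ‖1 - θ‖ + r / 10 := by
    rw [e₀]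
    refine (norm_sub_le _ _).trans ?_
    rw [norm_mul, norm_mul, hθ, one_mul, RCLike.norm_ofReal, abs_of_pos hr]
    gcongr
  have n₁ : ‖(r : 𝕜) + θ * y₁‖ ≤ r * ‖1 + θ‖ + r / 10 := by
    rw [e₁]
    refine (norm_add_le _ _).trans ?_
    rw [norm_mul, norm_mul, hθ, one_mul, RCLike.norm_ofReal, abs_of_pos hr]
    gcongr
  have := mul_le_mul_of_nonneg_left (norm_sub_one_add_norm_add_one_le hθ) hr.le
  linarith

namespace IsRISequenceSpace

/-- If the sets `A` on which the norm dominates the `ℓ₁`-norm are those of cardinality at most `N`,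
then the alternative Daugavet property forces `N ≤ 1`. -/
theorem card_le_one_of_dominatesSum_iff (hX : IsRISequenceSpace coord) (h : HasADP 𝕜 X) {N : ℕ}
    (hN : ∀ A, DominatesSum coord A ↔ A.card ≤ N) : N ≤ 1 := by
  by_contra! hN2
  have hNle : ∀ A, DominatesSum coord A → A.card ≤ N := fun A => (hN A).1
  set r : ℝ := (N : ℝ)⁻¹ with hr
  have hN0 : (2 : ℝ) ≤ N := by exact_mod_cast hN2
  have hr0 : 0 < r := by positivity
  have hNr : (N : ℝ) * r = 1 := mul_inv_cancel₀ (by positivity)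
  have hr1 : r ≤ 1 := by nlinarith
  set δ : ℝ := r ^ 2 / 1000 with hδ
  have hδ0 : 0 < δ := by positivity
  have hδr : 1000 * δ ≤ r := by nlinarith
  have hNδ : N * δ = r / 1000 := by
    rw [hδ]; linear_combination (r / 1000) * hNr
  have hnr : ‖(r : 𝕜)‖ = r := by rw [RCLike.norm_ofReal, abs_of_pos hr0]
  -- The flipped sign at `0` gives elements of the slice almost opposite entries at `0` and `1`,
  -- both in the support of `x` because `N ≥ 2`.
  let σ : ℕ → 𝕜 := fun i => if i = 0 then -1 else 1
  have hσ : ∀ i, σ i * σ i = 1 := fun i => by simp only [σ]; split_ifs <;> simp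
  have hσn : ∀ i, ‖σ i‖ = 1 := fun i => by simp only [σ]; split_ifs <;> simp
  have hcard : ∀ A : Finset ℕ, A.card ≤ N → ∑ i ∈ A, r ≤ 1 := fun A hA => by
    rw [Finset.sum_const, nsmul_eq_mul, ← hNr]; gcongr
  -- Any `N` entries of `u` have moduli summing to at most `1`, while `F` adds up all `N + 1` of
  -- them.
  set u := hX.comb (Finset.range (N + 1)) fun i => (r : 𝕜) * σ i with hu
  have hu1 : ‖u‖ ≤ 1 := hX.norm_le_of_sum_le h hNle fun A hA => by
    refine (Finset.sum_le_sum fun i _ => ?_).trans (hcard A hA)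
    rw [hu, hX.coord_comb]
    split_ifs
    · rw [norm_mul, hσn, mul_one, hnr]
    · simpa using hr0.le
  set F := hX.finFunctional (Finset.range (N + 1)) σ with hF
  have hFu : F u = ((1 + r : ℝ) : 𝕜) := by
    have : F u = ∑ i ∈ Finset.range (N + 1), (r : 𝕜) := by
      rw [hF, finFunctional_apply]
      refine Finset.sum_congr rfl fun i hi => ?_
      rw [hu, hX.coord_comb_mem _ hi, mul_left_comm, hσ, mul_one]
    rw [this, Finset.sum_const, Finset.card_range, nsmul_eq_mul, ← hNr]
    push_cast; ring
  have hFn : 1 + r ≤ ‖F‖ := by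
    have h1 := F.le_opNorm u
    rw [hFu, RCLike.norm_ofReal, abs_of_pos (by positivity)] at h1
    exact h1.trans (mul_le_of_le_one_right (norm_nonneg _) hu1)
  set x := hX.comb (Finset.range N) fun _ => (r : 𝕜) with hx
  have hxi : ∀ i, ‖coord x i‖ = if i ∈ Finset.range N then r else 0 := fun i => by
    rw [hx, hX.coord_comb]; split_ifs
    · exact hnr
    · exact norm_zero
  have hx1 : ‖x‖ ≤ 1 := hX.norm_le_of_sum_le h hNle fun A hA => by
    refine (Finset.sum_le_sum fun i _ => ?_).trans (hcard A hA)
    rw [hxi]; split_ifs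
    · exact le_rfl
    · exact hr0.le
  have hx2 : 1 ≤ ‖x‖ := by
    have h1 := (hN (Finset.range N)).2 (by simp) x
    rw [Finset.sum_congr rfl fun i hi => (hxi i).trans (if_pos hi)] at h1
    simpa [hNr] using h1
  obtain ⟨y, θ, hy, hθ, hFy, hxy⟩ := h.exists_slice (F := F) (x := x)
    (norm_pos_iff.1 (by linarith)) (norm_pos_iff.1 (by linarith)) hx1 hδ0
  have hre : ∀ i, RCLike.re (σ i * coord y i) ≤ ‖coord y i‖ := fun i =>
    (RCLike.re_le_norm _).trans (by rw [norm_mul, hσn, one_mul])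
  have hdom : ∀ A : Finset ℕ, A.card ≤ N → ∑ i ∈ A, ‖coord y i‖ ≤ 1 := fun A hA =>
    ((hN A).2 hA y).trans hy
  have herase : ∀ j ∈ Finset.range (N + 1), ((Finset.range (N + 1)).erase j).card = N :=
    fun j hj => by rw [Finset.card_erase_of_mem hj]; simp
  -- The coordinates other than `j` contribute at most `1` to `F y`, which is almost `1 + r`.
  have hlow : ∀ j ∈ Finset.range (N + 1), r - δ ≤ RCLike.re (σ j * coord y j) := fun j hj => by
    have h1 : RCLike.re (F y) = ∑ i ∈ Finset.range (N + 1), RCLike.re (σ i * coord y i) := by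
      rw [hF, finFunctional_apply, map_sum]
    rw [← Finset.add_sum_erase _ _ hj] at h1
    have h2 := (Finset.sum_le_sum fun i (_ : i ∈ (Finset.range (N + 1)).erase j) => hre i).trans
      (hdom _ (herase j hj).le)
    linarith
  -- Leaving out `k`, the `N` remaining moduli sum to at most `1`, and `N - 1` of them are at least
  -- `r - δ`.
  have hup : ∀ j ∈ Finset.range (N + 1), ∀ k ∈ Finset.range (N + 1), j ≠ k →
      ‖coord y j‖ ≤ 1.001 * r := fun j hj k hk hjk => by
    have hj' : j ∈ (Finset.range (N + 1)).erase k := Finset.mem_erase.2 ⟨hjk, hj⟩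
    have h1 := hdom _ (herase k hk).le
    rw [← Finset.add_sum_erase _ _ hj'] at h1
    have h2 : ∑ i ∈ ((Finset.range (N + 1)).erase k).erase j, (r - δ) ≤
        ∑ i ∈ ((Finset.range (N + 1)).erase k).erase j, ‖coord y i‖ :=
      Finset.sum_le_sum fun i hi => (hlow i (Finset.mem_of_mem_erase
        (Finset.mem_of_mem_erase hi))).trans (hre i)
    rw [Finset.sum_const, nsmul_eq_mul, Finset.card_erase_of_mem hj', herase k hk,
      Nat.cast_sub (by omega), Nat.cast_one] at h2
    nlinarith
  have m0 : 0 ∈ Finset.range (N + 1) := Finset.mem_range.2 (by omega)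
  have m1 : 1 ∈ Finset.range (N + 1) := Finset.mem_range.2 (by omega)
  have hy0 := norm_sub_ofReal_le hr0 hr1 (by rw [hδ]; linarith) (hlow 0 m0)
    (by rw [norm_mul, hσn, one_mul]; exact hup 0 m0 1 m1 (by norm_num))
  have hy1 := norm_sub_ofReal_le hr0 hr1 (by rw [hδ]; linarith) (hlow 1 m1)
    (by rw [norm_mul, hσn, one_mul]; exact hup 1 m1 0 m0 (by norm_num))
  have hopp := norm_add_norm_le_of_opposite hr0 hθ (y₀ := coord y 0) (y₁ := coord y 1)
    (by simpa [σ] using hy0) (by simpa [σ] using hy1) hδr ((hlow 0 m0).trans (hre 0))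
    ((hlow 1 m1).trans (hre 1))
  -- A set of at most `N` indices is either the support of `x`, losing `r / 2` at the coordinates
  -- `0` and `1`, or misses a point of it, losing `r`.
  have hfin : ‖x + θ • y‖ ≤ 2 - r / 2 := hX.norm_le_of_sum_le h hNle fun A hA => by
    have htri : ∀ i, ‖coord (x + θ • y) i‖ ≤ ‖coord x i‖ + ‖coord y i‖ := fun i => by
      rw [map_add, map_smul, Pi.add_apply, Pi.smul_apply, smul_eq_mul]
      refine (norm_add_le _ _).trans ?_
      rw [norm_mul, hθ, one_mul]
    have hAy := hdom A hA
    by_cases hsub : Finset.range N ⊆ A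
    · have hAeq : Finset.range N = A := Finset.eq_of_subset_of_card_le hsub (by simpa using hA)
      have h1 : ∑ i ∈ ({0, 1} : Finset ℕ),
          (‖coord x i‖ + ‖coord y i‖ - ‖coord (x + θ • y) i‖) ≤
          ∑ i ∈ A, (‖coord x i‖ + ‖coord y i‖ - ‖coord (x + θ • y) i‖) := by
        refine Finset.sum_le_sum_of_subset_of_nonneg ?_ fun i _ _ => by linarith [htri i]
        rw [← hAeq]
        intro i hi
        simp only [Finset.mem_insert, Finset.mem_singleton] at hi
        exact Finset.mem_range.2 (by omega)
      have hx0 : coord x 0 = (r : 𝕜) := hX.coord_comb_mem _ (Finset.mem_range.2 (by omega))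
      have hx1 : coord x 1 = (r : 𝕜) := hX.coord_comb_mem _ (Finset.mem_range.2 (by omega))
      rw [Finset.sum_pair zero_ne_one, Finset.sum_sub_distrib, Finset.sum_add_distrib] at h1
      simp only [map_add, map_smul, Pi.add_apply, Pi.smul_apply, smul_eq_mul, hx0, hx1, hnr]
        at h1 ⊢
      have h2 : ∑ i ∈ A, ‖coord x i‖ ≤ 1 := ((hN A).2 hA x).trans ‹‖x‖ ≤ 1›
      linarith
    · obtain ⟨k, hk, hkA⟩ := Finset.not_subset.1 hsub
      have h1 : ∑ i ∈ A, ‖coord x i‖ ≤ 1 - r := by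
        have h2 : ∑ i ∈ A, ‖coord x i‖ ≤ ∑ i ∈ (Finset.range N).erase k, r := by
          simp only [hxi]
          rw [← Finset.sum_filter]
          refine Finset.sum_le_sum_of_subset_of_nonneg (fun i hi => ?_) fun _ _ _ => hr0.le
          rw [Finset.mem_filter] at hi
          exact Finset.mem_erase.2 ⟨fun hik => hkA (hik ▸ hi.1), hi.2⟩
        rw [Finset.sum_const, nsmul_eq_mul, Finset.card_erase_of_mem hk, Finset.card_range,
          Nat.cast_sub (by omega), Nat.cast_one] at h2
        linarith
      have h2 := Finset.sum_le_sum fun i (_ : i ∈ A) => htri i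
      rw [Finset.sum_add_distrib] at h2
      linarith
  linarith

/-- A non-separable r.i. sequence space with the alternative Daugavet property has the supremum
norm. -/
theorem norm_le_of_forall_norm_coord_le (hX : IsRISequenceSpace coord) (h : HasADP 𝕜 X)
    (hsep : ¬ TopologicalSpace.SeparableSpace X) {x : X} {c : ℝ}
    (hc : ∀ n, ‖coord x n‖ ≤ c) : ‖x‖ ≤ c := by
  classical
  have hex : ∃ n, ¬ DominatesSum coord (Finset.range n) := by
    by_contra! hall
    exact hsep (hX.separableSpace_of_dominatesSum hall)
  obtain ⟨N, hN⟩ : ∃ N, Nat.find hex = N + 1 := Nat.exists_eq_succ_of_ne_zero fun h0 =>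
    Nat.find_spec hex (by rw [h0]; intro v; simp)
  have hbad : ¬ DominatesSum coord (Finset.range (N + 1)) := hN ▸ Nat.find_spec hex
  have hgood : DominatesSum coord (Finset.range N) :=
    not_not.1 (Nat.find_min hex (m := N) (by omega))
  have hiff : ∀ A, DominatesSum coord A ↔ A.card ≤ N := fun A => by
    constructor
    · intro hA
      by_contra! hcard
      obtain ⟨B, hBA, hB⟩ := Finset.exists_subset_card_eq (s := A) (n := N + 1) hcard
      exact hbad (hX.dominatesSum_of_card_eq (hA.mono hBA) (by simp [hB]))
    · intro hA
      exact hX.dominatesSum_of_card_eq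
        (hgood.mono (Finset.range_subset_range.2 hA)) (by simp)
  have hN1 := hX.card_le_one_of_dominatesSum_iff h hiff
  refine hX.norm_le_of_sum_le h (fun A hA => ((hiff A).1 hA).trans hN1) fun A hA => ?_
  rcases Nat.le_one_iff_eq_zero_or_eq_one.1 hA with hA | hA
  · rw [Finset.card_eq_zero.1 hA, Finset.sum_empty]
    exact (norm_nonneg _).trans (hc 0)
  · obtain ⟨i, rfl⟩ := Finset.card_eq_one.1 hA
    simpa using hc i

/-- The conjugate-sign sequence of `g` is not yet known to lie in `X`. Its truncations do, with norm
at most `1`, and Banach–Steinhaus bounds the truncations of `g` uniformly as functionals. -/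
theorem summable_of_mem_integrals [CompleteSpace X] (hX : IsRISequenceSpace coord)
    (hsup : ∀ (x : X) (c : ℝ), (∀ n, ‖coord x n‖ ≤ c) → ‖x‖ ≤ c) {g : ℕ → 𝕜}
    (hg : g ∈ integrals coord) : Summable fun n => ‖g n‖ := by
  obtain ⟨C, hC⟩ := banach_steinhaus (g := fun m => hX.finFunctional (Finset.range m) g)
    fun x => ⟨∑' n, ‖coord x n * g n‖, fun m => by
      rw [finFunctional_apply]
      refine (norm_sum_le _ _).trans ?_
      simp only [mul_comm (g _)]
      exact (hg _ ⟨x, rfl⟩).sum_le_tsum _ fun _ _ => norm_nonneg _⟩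
  choose c hc hcg using fun n => exists_unit_mul_eq_norm (g n)
  refine summable_of_sum_range_le (c := C) (fun _ => norm_nonneg _) fun m => ?_
  have h1 : hX.finFunctional (Finset.range m) g (hX.comb (Finset.range m) c) =
      ((∑ n ∈ Finset.range m, ‖g n‖ : ℝ) : 𝕜) := by
    rw [finFunctional_apply]
    push_cast
    exact Finset.sum_congr rfl fun n hn => by rw [hX.coord_comb_mem _ hn, mul_comm, hcg]
  have h2 : ‖hX.comb (Finset.range m) c‖ ≤ 1 := hsup _ _ fun n => by
    rw [hX.coord_comb]; split_ifs <;> simp [hc]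
  have h3 := (hX.finFunctional (Finset.range m) g).le_opNorm (hX.comb (Finset.range m) c)
  rw [h1, RCLike.norm_ofReal] at h3
  exact (le_abs_self _).trans (h3.trans
    ((mul_le_of_le_one_right (norm_nonneg _) h2).trans (hC m)))

theorem mem_range_of_bounded [CompleteSpace X] (hX : IsRISequenceSpace coord)
    (hsep : ¬ TopologicalSpace.SeparableSpace X)
    (hsup : ∀ (x : X) (c : ℝ), (∀ n, ‖coord x n‖ ≤ c) → ‖x‖ ≤ c) {f : ℕ → 𝕜} {C : ℝ}
    (hf : ∀ n, ‖f n‖ ≤ C) : f ∈ Set.range coord := by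
  rw [hX.range_eq_biIntegrals hsep]
  intro g hg
  refine Summable.of_nonneg_of_le (fun _ => norm_nonneg _) (fun n => ?_)
    ((hX.summable_of_mem_integrals hsup hg).mul_right C)
  rw [norm_mul]
  gcongr
  exact hf n

end IsRISequenceSpace

end LInfty

end RISeq

/-- A non-separable r.i. space `X` on `ℕ` with the alternative Daugavet property is `ℓ_∞`: it
consists of the bounded sequences, and its norm is the supremum norm. -/
theorem mainTheorem7 {𝕜 : Type*} [RCLike 𝕜]
    {X : Type*} [NormedAddCommGroup X] [NormedSpace 𝕜 X] [CompleteSpace X]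
    (coord : X →ₗ[𝕜] (ℕ → 𝕜)) (hX : RISeq.IsRISequenceSpace coord)
    (hsep : ¬ TopologicalSpace.SeparableSpace X) (hADP : RISeq.HasADP 𝕜 X) :
    ∃ Φ : X ≃ₗᵢ[𝕜] lp (fun _ : ℕ => 𝕜) ∞, ∀ (x : X) (n : ℕ), Φ x n = coord x n := by
  have hsup : ∀ (x : X) (c : ℝ), (∀ n, ‖coord x n‖ ≤ c) → ‖x‖ ≤ c := fun x c hc =>
    hX.norm_le_of_forall_norm_coord_le hADP hsep hc
  have hmem : ∀ x : X, Memℓp (coord x) ∞ := fun x =>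
    memℓp_infty ⟨‖x‖, by rintro _ ⟨n, rfl⟩; exact hX.le_linfty x n⟩
  let Ψ : X →ₗᵢ[𝕜] lp (fun _ : ℕ => 𝕜) ∞ :=
    { toFun := fun x => ⟨coord x, hmem x⟩
      map_add' := fun x y => Subtype.ext (map_add coord x y)
      map_smul' := fun c x => Subtype.ext (map_smul coord c x)
      norm_map' := fun x => le_antisymm
        (lp.norm_le_of_forall_le (norm_nonneg x) fun n => hX.le_linfty x n)
        (hsup x _ fun n => lp.norm_apply_le_norm ENNReal.top_ne_zero
          (⟨coord x, hmem x⟩ : lp (fun _ : ℕ => 𝕜) ∞) n) }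
  have hsurj : Function.Surjective Ψ := fun f => by
    obtain ⟨x, hx⟩ := hX.mem_range_of_bounded hsep hsup
      fun n => lp.norm_apply_le_norm ENNReal.top_ne_zero f n
    exact ⟨x, Subtype.ext hx⟩
  exact ⟨LinearIsometryEquiv.ofSurjective Ψ hsurj, fun x n => rfl⟩
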